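/- **Setting.** Let $q$ be a quantum variable of type integer, with state space $\mathcal H=\ell^2(\mathbb Z)$ and computational basis $\{|i\rangle : i\in\mathbb Z\}$; $\sqsubseteq$ is the Löwner order. A quantum operation is $\mathcal E=\sum_k E_k\diamond E_k^\dagger$ with $\sum_k E_k^\dagger E_k\sqsubseteq I$, acting by $\mathcal E(\rho)=\sum_k E_k\rho E_k^\dagger$ on states $\rho$ (positive, trace $\le 1$), with dual $\mathcal E^*(A)=\sum_k E_k^\dagger A E_k$. One writes $\mathcal E\sqsubseteq\mathcal F$ if $\mathcal E(\rho)\sqsubseteq\mathcal F(\rho)$ for all states $\rho$; for an increasing sequence, $\mathcal E=\lim_n\mathcal E_n$ means that $\mathcal E(\rho)$ is the least upper bound of $(\mathcal E_n(\rho))_n$ for every $\rho$. **Terms.** A parameterized quantum predicate term on $q$ is $P=\mathcal E^*(\mathcal X)+\mathcal F^*(I)$ with one parameter $\mathcal X$ (a variable ranging over operators $0\sqsubseteq A\sqsubseteq I$), or $P=\mathcal F^*(I)$ without parameter, where $\mathcal E+\mathcal F$ (resp. $\mathcal F$) is a quantum operation. $P[R/\mathcal X]$ is substitution of the term $R$ for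 $\mathcal X$. For terms with the same parameters, $P\sqsubseteq Q$ and $P=Q$ mean validity for all values of the parameter. An increasing sequence of terms is one of the form $P_n=\mathcal E_n^*(R)$ with a term $R$ and $\mathcal E_0\sqsubseteq\mathcal E_1\sqsubseteq\cdots$; then $\bigsqcup_n P_n=\mathcal E^*(R)$ with $\mathcal E=\lim_n\mathcal E_n$. **Programs and proof rules.** Statements are $S ::= \bot \mid \mathbf{skip}\mid q:=|0\rangle \mid q\mathrel{*}=U \mid S_1;S_2\mid \mathbf{if}\,(\Box m\cdot M[q]=m\to S_m)\mid \mathbf{call}\ \mathit{proc}$, with $U$ unitary, $M=\{M_m\}$ a measurement ($\sum_m M_m^\dagger M_m=I$), and one declared procedure $\mathit{proc}$ with a given body. Formulas $\langle P\rangle S\langle Q\rangle$ (total correctness) have $P,Q$ with the same parameters. The base system $\mathrm{qB}$ has the axioms $\langle 0\rangle\bot\langle P\rangle$, $\langle P\rangle\mathbf{skip}\langle P\rangle$, $\langle\sum_i|i\rangle\langle0|P|0\rangle\langle i|\rangle\,q:=|0\rangle\,\langle P\rangle$, $\langle U^\dagger PU\rangle\,q\mathrel{*}=U\,\langle P\rangle$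 and the rules * (R Comp) from $\langle P\rangle S_1\langle Q\rangle$ and $\langle Q\rangle S_2\langle R\rangle$ infer $\langle P\rangle S_1;S_2\langle R\rangle$; * (R Case) from $\langle P_m\rangle S_m\langle Q\rangle$ for each $m$ infer $\langle\sum_m M_m^\dagger P_mM_m\rangle\,\mathbf{if}\,(\Box m\cdot M[q]=m\to S_m)\,\langle Q\rangle$; * (R Order) from $\langle P'\rangle S\langle Q'\rangle$ and valid $P\sqsubseteq P'$, $Q'\sqsubseteq Q$ infer $\langle P\rangle S\langle Q\rangle$; * (R Subst) from $\langle P\rangle S\langle Q\rangle$ infer $\langle P[R/\mathcal X]\rangle S\langle Q[R/\mathcal X]\rangle$. * (Rt Rec): infer $\langle P\rangle\,\mathbf{call}\ \mathit{proc}\,\langle Q\rangle$ if there is an increasing sequence $(P_n)_{n\ge0}$ with $P_0=0$, $P\sqsubseteq\bigsqcup_nP_n$, and $\langle P_n\rangle\,\mathbf{call}\ \mathit{proc}\,\langle Q\rangle\vdash_{\mathrm{qB}}\langle P_{n+1}\rangle\,\mathit{body}\,\langle Q\rangle$ for all $n\ge0$. * (Rt Rec$'$), the variant with increasing postconditions: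 infer $\langle P\rangle\,\mathbf{call}\ \mathit{proc}\,\langle Q\rangle$ if there are increasing sequences $(P_n)_{n\ge0}$, $(Q_n)_{n\ge0}$ with $P_0=0$, $P\sqsubseteq\bigsqcup_nP_n$, $\bigsqcup_nQ_n\sqsubseteq Q$, and $\langle P_n\rangle\,\mathbf{call}\ \mathit{proc}\,\langle Q_n\rangle\vdash_{\mathrm{qB}}\langle P_{n+1}\rangle\,\mathit{body}\,\langle Q_{n+1}\rangle$ for all $n\ge0$. "Without (R Subst)" means that (R Subst) is removed from $\mathrm{qB}$ everywhere, including in the premises of (Rt Rec) and (Rt Rec$'$). **The procedures.** Let $U_{+i}|x\rangle=|x+i\rangle$, $U_{-i}=U_{+i}^{-1}$, $M_0=\sum_{i\le0}|i\rangle\langle i|$, $M_1=\sum_{i\ge1}|i\rangle\langle i|$. The procedure $\mathit{toy}$ has the body $\mathbf{if}\,(\Box m\cdot M[q]=m\to S_m)$ with $S_0=\mathbf{skip}$ and $S_1 = q\mathrel{*}=U_{-1};\ \mathbf{call}\ \mathit{toy};\ q\mathrel{*}=U_{+1}$. The procedure $\mathit{toy}'$ is the same (calling itself) with $S_1 = q\mathrel{*}=U_{-1};\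 \mathbf{call}\ \mathit{toy}';\ q\mathrel{*}=U_{-1};\ \mathbf{call}\ \mathit{toy}';\ q\mathrel{*}=U_{+2}$. **Claim.** For every integer $n\ge0$: 1. $\langle|n\rangle\langle n|\rangle\ \mathbf{call}\ \mathit{toy}\ \langle|n\rangle\langle n|\rangle$ is derivable in $\mathrm{qB}$ + (Rt Rec), but not without (R Subst). 2. $\langle|n\rangle\langle n|\rangle\ \mathbf{call}\ \mathit{toy}'\ \langle|n\rangle\langle n|\rangle$ is derivable in $\mathrm{qB}$ + (Rt Rec$'$), but not without (R Subst). -/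

import Mathlib

noncomputable section

namespace QHL

open scoped ENNReal

/-! ## The state space of a quantum variable of type integer -/

/-- `ℓ²(ℤ)`, the state Hilbert space of one quantum variable `q` of type integer. -/
abbrev H : Type := lp (fun _ : ℤ => ℂ) 2

/-- The computational basis vector `|i⟩`. -/
def ket (i : ℤ) : H := lp.single 2 i (1 : ℂ)

/-- The outer product `|i⟩⟨j|`. -/
def outer (i j : ℤ) : H →L[ℂ] H := InnerProductSpace.rankOne ℂ (ket i) (ket j)

theorem memlp_of_enorm {ι : Type} {E : ι → Type} [∀ i, NormedAddCommGroup (E i)]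
    {f : ∀ i, E i} (h : ∑' i, ‖f i‖ₑ ^ 2 ≠ ∞) : Memℓp f 2 := by
  apply memℓp_gen
  have := ENNReal.summable_toReal h
  simpa using this

theorem enorm_sq_lp {ι : Type} {E : ι → Type} [∀ i, NormedAddCommGroup (E i)]
    (f : lp E 2) : ‖f‖ₑ ^ 2 = ∑' i, ‖f i‖ₑ ^ 2 := by
  have h0 : (0 : ℝ) < (2 : ℝ≥0∞).toReal := by simp
  have h := lp.norm_rpow_eq_tsum h0 f
  have hs : Summable fun i => ‖f i‖ ^ 2 := by
    have := (lp.memℓp f).summable h0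
    simpa using this
  have h' : ‖f‖ ^ 2 = ∑' i, ‖f i‖ ^ 2 := by simpa using h
  have e : ∀ {F : Type} [NormedAddCommGroup F] (x : F), ‖x‖ₑ ^ 2 = ENNReal.ofReal (‖x‖ ^ 2) := by
    intro F _ x
    rw [← ofReal_norm, ENNReal.ofReal_pow (norm_nonneg _)]
  simp only [e]
  rw [h', ENNReal.ofReal_tsum_of_nonneg (fun _ => by positivity) hs]

theorem norm_le_of_enorm_sq {F G : Type} [NormedAddCommGroup F] [NormedAddCommGroup G]
    {x : F} {y : G} (h : ‖x‖ₑ ^ 2 ≤ ‖y‖ₑ ^ 2) : ‖x‖ ≤ ‖y‖ := by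
  have h2 : ‖x‖ₑ ≤ ‖y‖ₑ := (ENNReal.pow_le_pow_left_iff (by norm_num)).1 h
  rwa [enorm_le_iff_norm_le] at h2

theorem norm_le_mul_of_enorm_sq {F G K : Type} [NormedAddCommGroup F] [NormedAddCommGroup G]
    [NormedAddCommGroup K] {x : F} {y : G} {z : K} (h : ‖x‖ₑ ^ 2 ≤ (‖y‖ₑ * ‖z‖ₑ) ^ 2) :
    ‖x‖ ≤ ‖y‖ * ‖z‖ := by
  have h2 := (ENNReal.pow_le_pow_left_iff (by norm_num)).1 h
  rw [← ofReal_norm, ← ofReal_norm y, ← ofReal_norm z,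
    ← ENNReal.ofReal_mul (norm_nonneg _)] at h2
  exact (ENNReal.ofReal_le_ofReal_iff (by positivity)).1 h2

/-- The projection `∑_{i ∈ s} |i⟩⟨i|` onto the span of the basis vectors with index in `s`. -/
def proj (s : Set ℤ) : H →L[ℂ] H :=
  LinearMap.mkContinuous
    { toFun := fun f => ⟨s.indicator f, (lp.memℓp f).mono' (by
        intro i; by_cases h : i ∈ s <;> simp [h])⟩
      map_add' := by
        intro f g; ext i
        change s.indicator (f + g : ℤ → ℂ) i = s.indicator f i + s.indicator g i
        by_cases h : i ∈ s <;> simp [h]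
      map_smul' := by
        intro c f; ext i
        change s.indicator (c • f : ℤ → ℂ) i = c • s.indicator f i
        by_cases h : i ∈ s <;> simp [h] }
    1 (by
      intro f
      rw [one_mul]
      refine lp.norm_mono (by norm_num) (fun i => ?_)
      change ‖s.indicator f i‖ ≤ ‖f i‖
      by_cases h : i ∈ s <;> simp [h])

theorem proj_apply (s : Set ℤ) (f : H) (i : ℤ) : proj s f i = s.indicator f i := rfl

theorem memlp_shift (k : ℤ) (f : H) : Memℓp (fun x : ℤ => f (x - k)) 2 := by
  apply memlp_of_enorm
  have h : ∑' x : ℤ, ‖f (x - k)‖ₑ ^ 2 = ‖f‖ₑ ^ 2 :=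
    ((Equiv.subRight k).tsum_eq (fun i => ‖f i‖ₑ ^ 2)).trans (enorm_sq_lp f).symm
  exact ne_of_eq_of_ne h (ENNReal.pow_ne_top enorm_ne_top)

/-- The linear isometric bijection `|x⟩ ↦ |x + k⟩`, i.e. `f ↦ (x ↦ f (x - k))`. -/
def shiftIso (k : ℤ) : H ≃ₗᵢ[ℂ] H where
  toFun f := ⟨fun x => f (x - k), memlp_shift k f⟩
  invFun f := ⟨fun x => f (x - -k), memlp_shift (-k) f⟩
  map_add' := by intro f g; ext i; rfl
  map_smul' := by intro f g; ext i; rfl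
  left_inv := by intro f; ext i; simp
  right_inv := by intro f; ext i; simp
  norm_map' := by
    intro f
    have h : ‖(⟨fun x => f (x - k), memlp_shift k f⟩ : H)‖ₑ ^ 2 = ‖f‖ₑ ^ 2 := by
      rw [enorm_sq_lp, enorm_sq_lp]
      exact (Equiv.subRight k).tsum_eq (fun i => ‖f i‖ₑ ^ 2)
    exact le_antisymm (norm_le_of_enorm_sq h.le) (norm_le_of_enorm_sq h.ge)

/-- The unitary operator `U_{+k}`, with `U_{+k} |x⟩ = |x + k⟩`. -/
def shiftU (k : ℤ) : unitary (H →L[ℂ] H) := Unitary.linearIsometryEquiv.symm (shiftIso k)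

theorem shiftU_ket (k x : ℤ) : (shiftU k : H →L[ℂ] H) (ket x) = ket (x + k) := by
  ext i
  change (ket x) (i - k) = ket (x + k) i
  simp only [ket, lp.single_apply, Pi.single_apply]
  congr 1
  rw [eq_iff_iff]
  omega

/-! ## Quantum states, quantum predicates and quantum operations -/

/-- Partial density operators: positive operators of trace at most `1`. -/
def IsPDOP (ρ : H →L[ℂ] H) : Prop :=
  ρ.IsPositive ∧ Summable (fun i : ℤ => (inner ℂ (ket i) (ρ (ket i))).re) ∧
    ∑' i : ℤ, (inner ℂ (ket i) (ρ (ket i))).re ≤ 1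

/-- Quantum predicates `0 ⊑ A ⊑ I`; `≤` is the Löwner order. -/
def QPred : Type := {A : H →L[ℂ] H // 0 ≤ A ∧ A ≤ 1}

/-- A quantum operation `ℰ = ∑ₖ Eₖ ⋄ Eₖ†`, given by Kraus operators with `∑ₖ Eₖ† Eₖ ⊑ I`
(that is, `∑ₖ ‖Eₖ x‖² ≤ ‖x‖²` for all `x`). -/
structure QOp where
  ι : Type
  K : ι → H →L[ℂ] H
  adm : ∀ x : H, ∑' k, ‖K k x‖ₑ ^ 2 ≤ ‖x‖ₑ ^ 2

namespace QOp

/-- `ℰ(ρ) = ∑ₖ Eₖ ρ Eₖ†` (norm-convergent for partial density operators `ρ`). -/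
def app (E : QOp) (ρ : H →L[ℂ] H) : H →L[ℂ] H :=
  ∑' k, E.K k ∘L ρ ∘L ContinuousLinearMap.adjoint (E.K k)

/-- The contraction `x ↦ (Eₖ x)ₖ` from `H` to the direct sum of copies of `H`. -/
def column (E : QOp) : H →L[ℂ] lp (fun _ : E.ι => H) 2 :=
  LinearMap.mkContinuous
    { toFun := fun x => ⟨fun k => E.K k x,
        memlp_of_enorm (ne_top_of_le_ne_top (ENNReal.pow_ne_top enorm_ne_top) (E.adm x))⟩
      map_add' := by intro x y; ext1; funext k; exact map_add (E.K k) x y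
      map_smul' := by intro c x; ext1; funext k; exact map_smul (E.K k) c x }
    1 (by
      intro x
      rw [one_mul]
      apply norm_le_of_enorm_sq
      rw [enorm_sq_lp]
      exact E.adm x)

theorem tsum_ampl_le {ι : Type} (A : H →L[ℂ] H) (y : lp (fun _ : ι => H) 2) :
    ∑' k, ‖A (y k)‖ₑ ^ 2 ≤ (‖A‖ₑ * ‖y‖ₑ) ^ 2 := by
  rw [mul_pow, enorm_sq_lp y, ← ENNReal.tsum_mul_left]
  refine ENNReal.tsum_le_tsum fun k => ?_
  rw [← mul_pow]
  exact pow_le_pow_left' (A.le_opENorm (y k)) 2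

/-- The operator `(yₖ)ₖ ↦ (A yₖ)ₖ` on the direct sum of copies of `H`. -/
def ampl (ι : Type) (A : H →L[ℂ] H) :
    lp (fun _ : ι => H) 2 →L[ℂ] lp (fun _ : ι => H) 2 :=
  LinearMap.mkContinuous
    { toFun := fun y => ⟨fun k => A (y k), memlp_of_enorm (ne_top_of_le_ne_top
        (ENNReal.pow_ne_top (ENNReal.mul_ne_top enorm_ne_top enorm_ne_top)) (tsum_ampl_le A y))⟩
      map_add' := by intro x y; ext1; funext k; exact map_add A (x k) (y k)
      map_smul' := by intro c x; ext1; funext k; exact map_smul A c (x k) }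
    ‖A‖ (by
      intro y
      apply norm_le_mul_of_enorm_sq
      rw [enorm_sq_lp]
      exact tsum_ampl_le A y)

/-- The Schrödinger-Heisenberg dual `ℰ*(A) = ∑ₖ Eₖ† A Eₖ`; see `QOp.hasSum_dual`. -/
def dual (E : QOp) (A : H →L[ℂ] H) : H →L[ℂ] H :=
  ContinuousLinearMap.adjoint E.column ∘L ampl E.ι A ∘L E.column

theorem column_apply (E : QOp) (x : H) (k : E.ι) : E.column x k = E.K k x := rfl

theorem ampl_apply (ι : Type) (A : H →L[ℂ] H) (y : lp (fun _ : ι => H) 2) (k : ι) :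
    ampl ι A y k = A (y k) := rfl

theorem hasSum_dual (E : QOp) (A : H →L[ℂ] H) (x y : H) :
    HasSum (fun k => inner ℂ (E.K k x) (A (E.K k y))) (inner ℂ x (E.dual A y)) := by
  have e : inner ℂ x (E.dual A y) = inner ℂ (E.column x) (ampl E.ι A (E.column y)) := by
    rw [dual, ContinuousLinearMap.comp_apply, ContinuousLinearMap.adjoint_inner_right,
      ContinuousLinearMap.comp_apply]
  have e2 : (fun k => inner ℂ (E.K k x) (A (E.K k y))) =
      fun k => inner ℂ (E.column x k) (ampl E.ι A (E.column y) k) := by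
    funext k
    rw [ampl_apply, column_apply, column_apply]
  rw [e, e2]
  exact lp.hasSum_inner (𝕜 := ℂ) (E.column x) (ampl E.ι A (E.column y))

/-- The Löwner order on quantum operations: `ℰ(ρ) ⊑ ℱ(ρ)` for all states `ρ`. -/
def Le (E F : QOp) : Prop := ∀ ρ, IsPDOP ρ → E.app ρ ≤ F.app ρ

/-- `L = lim Eₙ` for an increasing sequence: `L(ρ)` is the least upper bound of the `Eₙ(ρ)`. -/
def IsLimit (E : ℕ → QOp) (L : QOp) : Prop :=
  ∀ ρ, IsPDOP ρ → IsLUB (Set.range fun n => (E n).app ρ) (L.app ρ)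

/-- The zero operation. -/
def zero : QOp where
  ι := Empty
  K := Empty.elim
  adm := by intro x; simp

/-- The operation `T ⋄ T†` of a contraction `T`. -/
def single (T : H →L[ℂ] H) (hT : ∀ x, ‖T x‖ ≤ ‖x‖) : QOp where
  ι := Unit
  K := fun _ => T
  adm := by
    intro x
    simp only [tsum_fintype, Finset.univ_unique, Finset.sum_singleton]
    exact pow_le_pow_left' (enorm_le_iff_norm_le.2 (hT x)) 2

/-- The operation `U ⋄ U†` of a unitary operator. -/
def ofUnitary (U : unitary (H →L[ℂ] H)) : QOp :=
  single U (fun x => ((Unitary.linearIsometryEquiv U).norm_map x).le)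

/-- The operation `∑ᵢ |0⟩⟨i| ⋄ |i⟩⟨0|` of the initialization `q := |0⟩`. -/
def init : QOp where
  ι := ℤ
  K := fun i => outer 0 i
  adm := by
    intro x
    rw [enorm_sq_lp x]
    apply le_of_eq
    congr 1
    funext i
    have h0 : ‖ket 0‖ = 1 := by simp [ket, lp.norm_single]
    have h1 : inner ℂ (ket i) x = x i := by
      simp [ket, lp.inner_single_left]
    rw [outer, InnerProductSpace.rankOne_apply, enorm_smul, h1, ← ofReal_norm (ket 0), h0]
    simp

end QOp

/-- Measurements `{Mₘ}ₘ` with `∑ₘ Mₘ† Mₘ = I` (that is, `∑ₘ ‖Mₘ x‖² = ‖x‖²` for all `x`). -/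
structure Measurement where
  J : Type
  M : J → H →L[ℂ] H
  complete : ∀ x : H, ∑' m, ‖M m x‖ₑ ^ 2 = ‖x‖ₑ ^ 2

/-- The operation `∑ₘ Mₘ ⋄ Mₘ†` of a measurement. -/
def Measurement.toQOp (M : Measurement) : QOp := ⟨M.J, M.M, fun x => (M.complete x).le⟩

/-! ## Programs with one recursive procedure -/

/-- Statements over `q`; `call` invokes the declared procedure, whose body is given separately. -/
inductive Stmt : Type 1
  | bot : Stmt
  | skip : Stmt
  | init : Stmt
  | unit (U : unitary (H →L[ℂ] H)) : Stmt
  | seq (S₁ S₂ : Stmt) : Stmt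
  | cases (M : Measurement) (S : M.J → Stmt) : Stmt
  | call : Stmt

/-! ## Parameterized quantum predicate terms -/

/-- A parameterized quantum predicate term on `q`. Its set of parameters is `{𝒳ₖ}` if `π = some k`
and empty if `π = none`. The term is `ℰ*(ℬ) + ℱ*(I)` where the base `ℬ` is the predicate variable
`𝒳ₖ` in the first case and the identity in the second, and where `ℰ + ℱ` is a quantum operation
(`∑ Eₖ† Eₖ + ∑ Fₖ† Fₖ ⊑ I`). -/
structure PQPT (π : Option ℕ) where
  E : QOp
  F : QOp
  adm : ∀ x : H, ∑' k, ‖E.K k x‖ₑ ^ 2 + ∑' k, ‖F.K k x‖ₑ ^ 2 ≤ ‖x‖ₑ ^ 2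

namespace PQPT

/-- The value of the base under an assignment of quantum predicates to predicate variables. -/
def base (v : ℕ → QPred) : Option ℕ → H →L[ℂ] H
  | none => 1
  | some k => (v k).1

/-- The denotation of a term under an assignment. -/
def den {π : Option ℕ} (P : PQPT π) (v : ℕ → QPred) : H →L[ℂ] H :=
  P.E.dual (base v π) + P.F.dual 1

/-- Validity of `P ⊑ Q`, for terms with the same parameters. -/
def Le {π : Option ℕ} (P Q : PQPT π) : Prop := ∀ v, P.den v ≤ Q.den v

/-- Validity of `P = Q`, for terms with the same parameters. -/
def Eqv {π : Option ℕ} (P Q : PQPT π) : Prop := P.Le Q ∧ Q.Le P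

/-- The term `0`. -/
def zero (π : Option ℕ) : PQPT π := ⟨QOp.zero, QOp.zero, by intro x; simp [QOp.zero]⟩

/-- The predicate variable `𝒳ₖ`. -/
def var (k : ℕ) : PQPT (some k) where
  E := QOp.ofUnitary 1
  F := QOp.zero
  adm := by intro x; simpa [QOp.zero] using (QOp.ofUnitary 1).adm x

/-- The parameterless term `|n⟩⟨n|`, as `ℱ*(I)` with `ℱ = |n⟩⟨n| ⋄ |n⟩⟨n|`. -/
def ketbra (n : ℤ) : PQPT none where
  E := QOp.zero
  F := QOp.single (outer n n) (by
    intro x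
    have h : ‖ket n‖ = 1 := by simp [ket, lp.norm_single]
    have h' : ‖outer n n‖ = 1 := by rw [outer, InnerProductSpace.norm_rankOne, h, mul_one]
    simpa [h'] using (outer n n).le_opNorm x)
  adm := by intro x; simpa [QOp.zero] using (QOp.single _ _).adm x

/-- The term `∑ⱼ Gⱼ† Pⱼ Gⱼ`, for a quantum operation `∑ⱼ Gⱼ ⋄ Gⱼ†` and terms `Pⱼ` with the
same parameters. -/
def disj {π : Option ℕ} (G : QOp) (P : G.ι → PQPT π) : PQPT π where
  E :=
    { ι := Σ j, (P j).E.ι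
      K := fun a => (P a.1).E.K a.2 ∘L G.K a.1
      adm := by
        intro x
        rw [ENNReal.tsum_sigma']
        exact (ENNReal.tsum_le_tsum fun j => (P j).E.adm (G.K j x)).trans (G.adm x) }
  F :=
    { ι := Σ j, (P j).F.ι
      K := fun a => (P a.1).F.K a.2 ∘L G.K a.1
      adm := by
        intro x
        rw [ENNReal.tsum_sigma']
        exact (ENNReal.tsum_le_tsum fun j => (P j).F.adm (G.K j x)).trans (G.adm x) }
  adm := by
    intro x
    simp only [ENNReal.tsum_sigma']
    rw [← ENNReal.tsum_add]
    exact (ENNReal.tsum_le_tsum fun j => (P j).adm (G.K j x)).trans (G.adm x)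

/-- The term `𝒢*(P)`. -/
def pull {π : Option ℕ} (G : QOp) (P : PQPT π) : PQPT π := disj G fun _ => P

/-- The substitution `P[R/𝒳ₖ]` in a term `P` with parameter `𝒳ₖ`: if `P = ℰ*(𝒳ₖ) + ℱ*(I)`
and `R = 𝒞*(ℬ) + 𝒟*(I)`, then `P[R/𝒳ₖ] = ℰ*(𝒞*(ℬ)) + (ℰ*(𝒟*(I)) + ℱ*(I))`. -/
def subst {k : ℕ} {π : Option ℕ} (P : PQPT (some k)) (R : PQPT π) : PQPT π where
  E :=
    { ι := P.E.ι × R.E.ι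
      K := fun a => R.E.K a.2 ∘L P.E.K a.1
      adm := by
        intro x
        rw [ENNReal.tsum_prod']
        exact (ENNReal.tsum_le_tsum fun j => R.E.adm (P.E.K j x)).trans (P.E.adm x) }
  F :=
    { ι := (P.E.ι × R.F.ι) ⊕ P.F.ι
      K := Sum.elim (fun a => R.F.K a.2 ∘L P.E.K a.1) P.F.K
      adm := by
        intro x
        rw [ENNReal.summable.tsum_sum ENNReal.summable]
        refine le_trans (add_le_add_left ?_ _) (P.adm x)
        rw [ENNReal.tsum_prod']
        exact ENNReal.tsum_le_tsum fun j => R.F.adm (P.E.K j x) }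
  adm := by
    intro x
    rw [ENNReal.summable.tsum_sum ENNReal.summable, ← add_assoc]
    refine le_trans (add_le_add_left ?_ _) (P.adm x)
    simp only [Sum.elim_inl]
    rw [ENNReal.tsum_prod', ENNReal.tsum_prod', ← ENNReal.tsum_add]
    exact ENNReal.tsum_le_tsum fun j => R.adm (P.E.K j x)

end PQPT

/-! ## Proof systems for total correctness -/

/-- A total correctness formula `⟨P⟩ S ⟨Q⟩`, with `P` and `Q` having the same parameters. -/
structure Triple where
  {π : Option ℕ}
  pre : PQPT π
  stmt : Stmt
  post : PQPT π

/-- Derivability, from the triples in `Γ` and all true order formulas between terms, in the base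
proof system for total correctness: with (R Subst) if `sub` holds, without it otherwise.
(Substitution for a variable that is not a parameter of the triple would change nothing.) -/
inductive Base (sub : Prop) (Γ : Set Triple) : Triple → Prop
  | hyp {t : Triple} (h : t ∈ Γ) : Base sub Γ t
  | bot {π : Option ℕ} (P : PQPT π) : Base sub Γ ⟨PQPT.zero π, Stmt.bot, P⟩
  | skip {π : Option ℕ} (P : PQPT π) : Base sub Γ ⟨P, Stmt.skip, P⟩
  | init {π : Option ℕ} (P : PQPT π) : Base sub Γ ⟨P.pull QOp.init, Stmt.init, P⟩
  | unit {π : Option ℕ} (U : unitary (H →L[ℂ] H)) (P : PQPT π) :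
      Base sub Γ ⟨P.pull (QOp.ofUnitary U), Stmt.unit U, P⟩
  | comp {π : Option ℕ} {P Q R : PQPT π} {S₁ S₂ : Stmt}
      (h₁ : Base sub Γ ⟨P, S₁, Q⟩) (h₂ : Base sub Γ ⟨Q, S₂, R⟩) :
      Base sub Γ ⟨P, Stmt.seq S₁ S₂, R⟩
  | cases {π : Option ℕ} (M : Measurement) {S : M.J → Stmt} {P : M.J → PQPT π} {Q : PQPT π}
      (h : ∀ m, Base sub Γ ⟨P m, S m, Q⟩) :
      Base sub Γ ⟨PQPT.disj M.toQOp P, Stmt.cases M S, Q⟩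
  | order {π : Option ℕ} {P P' Q Q' : PQPT π} {S : Stmt}
      (hP : P.Le P') (h : Base sub Γ ⟨P', S, Q'⟩) (hQ : Q'.Le Q) : Base sub Γ ⟨P, S, Q⟩
  | subst {k : ℕ} {π : Option ℕ} {P Q : PQPT (some k)} {S : Stmt} (R : PQPT π)
      (hsub : sub) (h : Base sub Γ ⟨P, S, Q⟩) : Base sub Γ ⟨P.subst R, S, Q.subst R⟩

/-- `⊔ₙ Pₙ = L` for an increasing sequence of terms, in the form `Pₙ = ℰₙ*(R)`, `L = ℰ*(R)` with
an increasing sequence of quantum operations `ℰₙ` and `ℰ = lim ℰₙ`. -/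
def IncreasingTo {π : Option ℕ} (P : ℕ → PQPT π) (L : PQPT π) : Prop :=
  ∃ (E : ℕ → QOp) (E' : QOp) (R : PQPT π),
    (∀ n, (E n).Le (E (n + 1))) ∧ QOp.IsLimit E E' ∧
      (∀ n, (P n).Eqv (R.pull (E n))) ∧ L.Eqv (R.pull E')

/-- The triples concluded by (Rt Rec) for the procedure with the given body: `⟨P⟩ call ⟨Q⟩`, if
`P ⊑ ⊔ₙ Pₙ` for an increasing sequence with `P₀ = 0` and, for all `n`, the triple
`⟨Pₙ₊₁⟩ body ⟨Q⟩` is derivable from `⟨Pₙ⟩ call ⟨Q⟩` in the base system. -/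
inductive RtRec (sub : Prop) (body : Stmt) : Triple → Prop
  | intro {π : Option ℕ} {P L Q : PQPT π} (Pn : ℕ → PQPT π)
      (hinc : IncreasingTo Pn L) (h0 : (Pn 0).Eqv (PQPT.zero π))
      (hstep : ∀ n, Base sub {⟨Pn n, Stmt.call, Q⟩} ⟨Pn (n + 1), body, Q⟩)
      (hP : P.Le L) : RtRec sub body ⟨P, Stmt.call, Q⟩

/-- The triples concluded by the variant of (Rt Rec) with increasing postconditions `Qₙ`, where
`⟨Pₙ₊₁⟩ body ⟨Qₙ₊₁⟩` is derivable from `⟨Pₙ⟩ call ⟨Qₙ⟩` and `⊔ₙ Qₙ ⊑ Q`. -/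
inductive RtRecVar (sub : Prop) (body : Stmt) : Triple → Prop
  | intro {π : Option ℕ} {P L L' Q : PQPT π} (Pn Qn : ℕ → PQPT π)
      (hinc : IncreasingTo Pn L) (hinc' : IncreasingTo Qn L')
      (h0 : (Pn 0).Eqv (PQPT.zero π))
      (hstep : ∀ n, Base sub {⟨Pn n, Stmt.call, Qn n⟩} ⟨Pn (n + 1), body, Qn (n + 1)⟩)
      (hP : P.Le L) (hQ : L'.Le Q) : RtRecVar sub body ⟨P, Stmt.call, Q⟩

/-- Derivability in the base system plus (Rt Rec). As the premises of (Rt Rec) only involve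
derivations in the base system, this is derivability in the base system from its conclusions. -/
def Provable (sub : Prop) (body : Stmt) (t : Triple) : Prop :=
  Base sub {s | RtRec sub body s} t

/-- Derivability in the base system plus the variant of (Rt Rec). -/
def ProvableVar (sub : Prop) (body : Stmt) (t : Triple) : Prop :=
  Base sub {s | RtRecVar sub body s} t

/-! ## The procedures -/

/-- The measurement `M₀ = ∑_{i ≤ 0} |i⟩⟨i|`, `M₁ = ∑_{i ≥ 1} |i⟩⟨i|`. -/
def toyM : Measurement where
  J := Fin 2
  M := ![proj {i | i ≤ 0}, proj {i | 1 ≤ i}]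
  complete := by
    intro x
    rw [tsum_fintype, Fin.sum_univ_two]
    simp only [Matrix.cons_val_zero, Matrix.cons_val_one]
    rw [enorm_sq_lp, enorm_sq_lp, enorm_sq_lp x, ← ENNReal.tsum_add]
    congr 1
    funext i
    simp only [proj_apply, Set.indicator_apply, Set.mem_ofPred_eq]
    rcases le_or_gt i 0 with h | h
    · simp [h, show ¬ (1 ≤ i) by omega]
    · simp [not_le.2 h, show 1 ≤ i by omega]

/-- The body of `toy`: `if M[q] = 0 → skip ▯ 1 → q *= U₋₁; call toy; q *= U₊₁`. -/
def toyBody : Stmt :=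
  .cases toyM (![.skip,
    .seq (.unit (shiftU (-1))) (.seq .call (.unit (shiftU 1)))] : Fin 2 → Stmt)

/-- The body of `toy` with the branch of outcome `1` replaced by
`q *= U₋₁; call toy; q *= U₋₁; call toy; q *= U₊₂`. -/
def toyBody' : Stmt :=
  .cases toyM (![.skip,
    .seq (.unit (shiftU (-1))) (.seq .call (.seq (.unit (shiftU (-1)))
      (.seq .call (.unit (shiftU 2)))))] : Fin 2 → Stmt)

end QHL

end

noncomputable section

namespace QHL

open ContinuousLinearMap

/-! Write `Π₀` for the projection onto the span of `|i⟩`, `i ≤ 0`, and `Πₖ = |k⟩⟨k|` for `k ≥ 1`.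
Both procedures implement the dephasing `ρ ↦ ∑ₖ Πₖ ρ Πₖ`.

With (R Subst), the recursion is proved once for a generic postcondition: `⟨∑_{k<n} Πₖ 𝒳 Πₖ⟩ call
⟨𝒳⟩` yields the same triple for the body with `n + 1`, since each inner call may instantiate `𝒳` by
the precondition of the statement following it (`base_call_subst`). Each term inequality is obtained
by matching Kraus operators injectively (`PQPT.le_of_injective`). Putting `𝒳 = |n⟩⟨n|` in the limit
gives the required triple.

Without (R Subst), every call in the body must use the assumed triple itself, under one fixed
assignment (`Base.sat`). The final shift then bounds the diagonal of the assumed postcondition at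
`j` by that of the new postcondition at `j + 1`, or `j + 2` for `toy'`. If the postconditions lie
below `|m⟩⟨m|`, their diagonals vanish off `m`, hence by the shift also at `m`. Induction on `n`
gives the preconditions `Pₙ` zero diagonal too, and so has their supremum
(`IncreasingTo.diag_eq_zero_iff`); it cannot dominate `|m⟩⟨m|`. -/

/-! ### The Löwner order through quadratic forms -/

theorem norm_ket (i : ℤ) : ‖ket i‖ = 1 := by simp [ket, lp.norm_single]

theorem inner_ket (i : ℤ) (x : H) : inner ℂ (ket i) x = x i := by
  simp [ket, lp.inner_single_left]

/-- The diagonal entry `⟨j|A|j⟩`. -/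
def diag (A : H →L[ℂ] H) (j : ℤ) : ℝ := (inner ℂ (ket j) (A (ket j))).re

theorem re_inner_mono {A B : H →L[ℂ] H} (h : A ≤ B) (x : H) :
    (inner ℂ x (A x)).re ≤ (inner ℂ x (B x)).re := by
  have h1 : 0 ≤ (inner ℂ x ((B - A) x)).re :=
    ((ContinuousLinearMap.le_def A B).1 h).re_inner_nonneg_right x
  rw [sub_apply, inner_sub_right, Complex.sub_re] at h1
  linarith

theorem re_inner_nonneg {A : H →L[ℂ] H} (h : 0 ≤ A) (x : H) : 0 ≤ (inner ℂ x (A x)).re := by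
  simpa using re_inner_mono h x

theorem diag_mono {A B : H →L[ℂ] H} (h : A ≤ B) (j : ℤ) : diag A j ≤ diag B j :=
  re_inner_mono h _

theorem diag_nonneg {A : H →L[ℂ] H} (h : 0 ≤ A) (j : ℤ) : 0 ≤ diag A j :=
  re_inner_nonneg h _

theorem le_of_re_inner {A B : H →L[ℂ] H} (hA : IsSelfAdjoint A) (hB : IsSelfAdjoint B)
    (h : ∀ x : H, (inner ℂ x (A x)).re ≤ (inner ℂ x (B x)).re) : A ≤ B := by
  rw [ContinuousLinearMap.le_def, isPositive_def']
  refine ⟨hB.sub hA, fun x => ?_⟩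
  rw [reApplyInnerSelf_apply, inner_re_symm, sub_apply, inner_sub_right]
  simpa using h x

theorem isSelfAdjoint_of_nonneg {A : H →L[ℂ] H} (h : 0 ≤ A) : IsSelfAdjoint A :=
  ((nonneg_iff_isPositive A).1 h).isSelfAdjoint

/-- Factor `A = B* B`; then `⟨x, A x⟩ = ‖B x‖²`, so `B x = 0`. -/
theorem apply_eq_zero_of_re_inner {V : Type*} [NormedAddCommGroup V] [InnerProductSpace ℂ V]
    [CompleteSpace V] {A : V →L[ℂ] V} (h : 0 ≤ A) {x : V}
    (hx : (inner ℂ x (A x)).re = 0) : A x = 0 := by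
  obtain ⟨B, rfl⟩ := (CStarAlgebra.nonneg_iff_eq_star_mul_self).1 h
  rw [star_eq_adjoint, mul_def, comp_apply] at hx ⊢
  rw [adjoint_inner_right, inner_self_eq_norm_sq_to_K] at hx
  have h0 : ‖B x‖ ^ 2 = 0 := by exact_mod_cast hx
  rw [norm_eq_zero.1 (pow_eq_zero_iff two_ne_zero |>.1 h0), map_zero]

theorem conj_mono {A B : H →L[ℂ] H} (h : A ≤ B) (T : H →L[ℂ] H) :
    adjoint T ∘L A ∘L T ≤ adjoint T ∘L B ∘L T := by
  rw [ContinuousLinearMap.le_def] at h ⊢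
  have := h.adjoint_conj T
  rwa [sub_comp, comp_sub] at this

/-! ### Duals of operations and values of terms -/

namespace QOp

theorem hasSum_re_dual (E : QOp) (A : H →L[ℂ] H) (x : H) :
    HasSum (fun k => (inner ℂ (E.K k x) (A (E.K k x))).re) (inner ℂ x (E.dual A x)).re :=
  Complex.hasSum_re (E.hasSum_dual A x x)

theorem isSelfAdjoint_dual (E : QOp) {A : H →L[ℂ] H} (hA : IsSelfAdjoint A) :
    IsSelfAdjoint (E.dual A) := by
  rw [ContinuousLinearMap.isSelfAdjoint_iff_isSymmetric] at hA ⊢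
  intro x y
  change inner ℂ (E.dual A x) y = inner ℂ x (E.dual A y)
  rw [← inner_conj_symm]
  refine HasSum.unique ?_ (E.hasSum_dual A x y)
  refine ((E.hasSum_dual A y x).star).congr_fun fun k => ?_
  exact ((inner_conj_symm _ _).trans (hA _ _)).symm

theorem dual_nonneg (E : QOp) {A : H →L[ℂ] H} (hA : 0 ≤ A) : 0 ≤ E.dual A :=
  le_of_re_inner (IsSelfAdjoint.zero _) (E.isSelfAdjoint_dual (isSelfAdjoint_of_nonneg hA))
    fun x => by
      simpa using (E.hasSum_re_dual A x).nonneg fun k => re_inner_nonneg hA _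

/-- The Kraus operators outside the range of `f` contribute nonnegative terms to the quadratic form.
-/
theorem dual_le_of_injective {E F : QOp} {A : H →L[ℂ] H} (hA : 0 ≤ A) (f : E.ι → F.ι)
    (hf : f.Injective) (h : ∀ k, E.K k = F.K (f k)) : E.dual A ≤ F.dual A := by
  have hs := isSelfAdjoint_of_nonneg hA
  refine le_of_re_inner (E.isSelfAdjoint_dual hs) (F.isSelfAdjoint_dual hs) fun x => ?_
  refine hasSum_le_inj f hf (fun c _ => re_inner_nonneg hA _) (fun k => ?_)
    (E.hasSum_re_dual A x) (F.hasSum_re_dual A x)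
  rw [h]

end QOp

namespace PQPT

variable {π : Option ℕ}

theorem base_nonneg (v : ℕ → QPred) : ∀ π, 0 ≤ base v π
  | none => (nonneg_iff_isPositive _).2 isPositive_one
  | some k => (v k).2.1

theorem den_nonneg (P : PQPT π) (v : ℕ → QPred) : 0 ≤ P.den v :=
  add_nonneg (P.E.dual_nonneg (base_nonneg v π)) (P.F.dual_nonneg (base_nonneg v none))

theorem le_of_injective {P Q : PQPT π} (f : P.E.ι → Q.E.ι) (hf : f.Injective)
    (hE : ∀ k, P.E.K k = Q.E.K (f k)) (g : P.F.ι → Q.F.ι) (hg : g.Injective)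
    (hF : ∀ k, P.F.K k = Q.F.K (g k)) : P.Le Q := fun v =>
  add_le_add (QOp.dual_le_of_injective (base_nonneg v π) f hf hE)
    (QOp.dual_le_of_injective (base_nonneg v none) g hg hF)

theorem Le.refl (P : PQPT π) : P.Le P := fun _ => le_rfl

theorem Eqv.refl (P : PQPT π) : P.Eqv P := ⟨Le.refl P, Le.refl P⟩

/-- The double sums over Kraus indices are regrouped by the outer index. Working with matrix
coefficients avoids any operator topology. -/
theorem hasSum_den_disj (G : QOp) (P : G.ι → PQPT π) (v : ℕ → QPred) (x y : H) :
    HasSum (fun j => inner ℂ (G.K j x) ((P j).den v (G.K j y)))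
      (inner ℂ x ((disj G P).den v y)) := by
  have h1 := ((disj G P).E.hasSum_dual (base v π) x y).sigma
    fun j => (P j).E.hasSum_dual (base v π) (G.K j x) (G.K j y)
  have h2 := ((disj G P).F.hasSum_dual 1 x y).sigma
    fun j => (P j).F.hasSum_dual 1 (G.K j x) (G.K j y)
  have h := h1.add h2
  simpa only [den, add_apply, inner_add_right] using h

theorem den_pull_ofUnitary (U : unitary (H →L[ℂ] H)) (P : PQPT π) (v : ℕ → QPred) :
    (P.pull (QOp.ofUnitary U)).den v =
      adjoint (U : H →L[ℂ] H) ∘L P.den v ∘L (U : H →L[ℂ] H) := by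
  ext1 y
  refine ext_inner_left ℂ fun x => ?_
  rw [comp_apply, comp_apply, adjoint_inner_right]
  exact (hasSum_den_disj (QOp.ofUnitary U) (fun _ => P) v x y).unique
    (hasSum_unique (β := Unit) _)

end PQPT

/-! ## Operations on basis states -/

theorem isPDOP_outer (j : ℤ) : IsPDOP (outer j j) := by
  have h : (fun i : ℤ => (inner ℂ (ket i) (outer j j (ket i))).re) = Pi.single j 1 := by
    funext i
    rw [outer, InnerProductSpace.rankOne_apply, inner_smul_right, inner_ket, inner_ket]
    by_cases hij : i = j
    · subst hij; simp [ket]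
    · simp [ket, hij, Ne.symm hij]
  refine ⟨InnerProductSpace.isPositive_rankOne_self _, ?_, ?_⟩
  · rw [h]; exact (hasSum_pi_single j (1 : ℝ)).summable
  · rw [h, (hasSum_pi_single j (1 : ℝ)).tsum_eq]

namespace QOp

theorem summable_norm_sq (E : QOp) (x : H) : Summable fun k => ‖E.K k x‖ ^ 2 := by
  have := ENNReal.summable_toReal
    (ne_top_of_le_ne_top (ENNReal.pow_ne_top enorm_ne_top) (E.adm x))
  simpa using this

theorem hasSum_app_outer (E : QOp) (j : ℤ) (x y : H) :
    HasSum (fun k => inner ℂ x (E.K k (ket j)) * inner ℂ (E.K k (ket j)) y)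
      (inner ℂ x (E.app (outer j j) y)) := by
  have e : ∀ k, E.K k ∘L outer j j ∘L adjoint (E.K k) =
      InnerProductSpace.rankOne ℂ (E.K k (ket j)) (E.K k (ket j)) := by
    intro k
    rw [outer, InnerProductSpace.rankOne_comp, InnerProductSpace.comp_rankOne, adjoint_adjoint]
  have hs : Summable fun k => E.K k ∘L outer j j ∘L adjoint (E.K k) := by
    refine Summable.of_norm ?_
    simp only [e, InnerProductSpace.norm_rankOne, ← pow_two]
    exact E.summable_norm_sq (ket j)
  have h := (hs.hasSum.mapL (ContinuousLinearMap.apply ℂ H y)).mapL (innerSL ℂ x)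
  refine h.congr_fun fun k => ?_
  simp only [e, apply_apply, innerSL_apply_apply, InnerProductSpace.rankOne_apply,
    inner_smul_right]
  exact mul_comm _ _

end QOp

/-! ## Vanishing diagonal entries along limits -/

/-- The diagonal entry is a sum of nonnegative terms `⟨Eₖ j, R (Eₖ j)⟩`. Vanishing thus becomes
membership of the Kraus vectors in the closed subspace `ker R`, a condition that can be tested on
the state `|j⟩⟨j|` in the Schrödinger picture, where limits of operations are defined. -/
theorem diag_pull_eq_zero_iff {π : Option ℕ} (E : QOp) (R : PQPT π) (v : ℕ → QPred) (j : ℤ) :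
    diag ((R.pull E).den v) j = 0 ↔ ∀ k, R.den v (E.K k (ket j)) = 0 := by
  have h : HasSum (fun k => (inner ℂ (E.K k (ket j)) (R.den v (E.K k (ket j)))).re)
      (diag ((R.pull E).den v) j) :=
    Complex.hasSum_re (PQPT.hasSum_den_disj E (fun _ => R) v (ket j) (ket j))
  constructor
  · intro h0 k
    rw [h0, hasSum_zero_iff_of_nonneg fun k => re_inner_nonneg (R.den_nonneg v) _] at h
    exact apply_eq_zero_of_re_inner (R.den_nonneg v) (congrFun h k)
  · intro h0
    refine h.unique ?_
    simp [h0, hasSum_zero]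

namespace QOp

/-- The quadratic form of `ℰ(|j⟩⟨j|)` at `y` is `∑ₖ |⟨y, Eₖ j⟩|²`. -/
theorem re_inner_app_outer_eq_zero_iff (E : QOp) (j : ℤ) (y : H) :
    (inner ℂ y (E.app (outer j j) y)).re = 0 ↔ ∀ k, inner ℂ y (E.K k (ket j)) = 0 := by
  have h := Complex.hasSum_re (E.hasSum_app_outer j y y)
  have e : ∀ k, (inner ℂ y (E.K k (ket j)) * inner ℂ (E.K k (ket j)) y).re =
      ‖inner ℂ y (E.K k (ket j))‖ ^ 2 := by
    intro k
    rw [← inner_conj_symm (E.K k (ket j)) y, Complex.mul_conj, Complex.normSq_eq_norm_sq,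
      Complex.ofReal_re]
  simp only [e] at h
  constructor
  · intro h0 k
    rw [h0, hasSum_zero_iff_of_nonneg fun k => by positivity] at h
    simpa using congrFun h k
  · intro h0
    refine h.unique ?_
    simp [h0, hasSum_zero]

theorem app_outer_nonneg (E : QOp) (j : ℤ) : 0 ≤ E.app (outer j j) := by
  rw [nonneg_iff_isPositive, isPositive_iff_complex]
  intro x
  have h := E.hasSum_app_outer j x x
  have e : ∀ k, inner ℂ x (E.K k (ket j)) * inner ℂ (E.K k (ket j)) x =
      ((‖inner ℂ x (E.K k (ket j))‖ ^ 2 : ℝ) : ℂ) := by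
    intro k
    rw [← inner_conj_symm (E.K k (ket j)) x, Complex.mul_conj, Complex.normSq_eq_norm_sq]
  simp only [e] at h
  have hr := Complex.hasSum_re h
  simp only [Complex.ofReal_re] at hr
  have hc := (Complex.hasSum_ofReal.2 hr).unique h
  have hn := hr.nonneg fun k => by positivity
  rw [← inner_conj_symm, ← hc]
  simpa using hn

/-- The Kraus vectors at `|j⟩` lie in a closed subspace `V` if and only if the image of `|j⟩⟨j|`
vanishes on `Vᗮ`. -/
theorem forall_mem_iff (E : QOp) (j : ℤ) (V : Submodule ℂ H) [V.HasOrthogonalProjection] :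
    (∀ k, E.K k (ket j) ∈ V) ↔ ∀ y ∈ Vᗮ, (inner ℂ y (E.app (outer j j) y)).re = 0 := by
  simp only [re_inner_app_outer_eq_zero_iff]
  constructor
  · intro h y hy k
    exact (Submodule.mem_orthogonal' V y).1 hy _ (h k)
  · intro h k
    rw [← Submodule.orthogonal_orthogonal V, Submodule.mem_orthogonal]
    exact fun y hy => h y hy k

theorem app_outer_eq_conj (E : QOp) (j : ℤ) (V : Submodule ℂ H) [V.HasOrthogonalProjection]
    (h : ∀ k, E.K k (ket j) ∈ V) :
    adjoint V.starProjection ∘L E.app (outer j j) ∘L V.starProjection = E.app (outer j j) := by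
  ext1 y
  refine ext_inner_left ℂ fun x => ?_
  rw [comp_apply, comp_apply, adjoint_inner_right]
  refine HasSum.unique ?_ (E.hasSum_app_outer j x y)
  refine (E.hasSum_app_outer j _ _).congr_fun fun k => ?_
  rw [Submodule.inner_starProjection_left_eq_right, ← Submodule.inner_starProjection_left_eq_right V
    (E.K k (ket j)), Submodule.starProjection_eq_self_iff.2 (h k)]

/-- Only the least upper bound property is used, not convergence. From right to left: compressing
the upper bound `L(|j⟩⟨j|)` by the projection onto `V` leaves every `Eₙ(|j⟩⟨j|)` unchanged, so the
compression is again an upper bound. Leastness puts `L(|j⟩⟨j|)` below it, and it vanishes on `Vᗮ`.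
-/
theorem IsLimit.forall_mem_iff {E : ℕ → QOp} {L : QOp} (hL : IsLimit E L) (j : ℤ)
    (V : Submodule ℂ H) [V.HasOrthogonalProjection] :
    (∀ k, L.K k (ket j) ∈ V) ↔ ∀ n k, (E n).K k (ket j) ∈ V := by
  obtain ⟨hub, hleast⟩ := hL (outer j j) (isPDOP_outer j)
  constructor
  · intro h n
    rw [QOp.forall_mem_iff] at h ⊢
    intro y hy
    have h1 := re_inner_mono (hub ⟨n, rfl⟩) y
    have h2 := re_inner_nonneg ((E n).app_outer_nonneg j) y
    rw [h y hy] at h1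
    exact le_antisymm h1 h2
  · intro h
    have h1 : L.app (outer j j) ≤
        adjoint V.starProjection ∘L L.app (outer j j) ∘L V.starProjection := by
      refine hleast ?_
      rintro _ ⟨n, rfl⟩
      have h2 := conj_mono (hub ⟨n, rfl⟩) V.starProjection
      rwa [app_outer_eq_conj (E n) j V (h n)] at h2
    rw [QOp.forall_mem_iff]
    intro y hy
    have h2 := re_inner_mono h1 y
    rw [comp_apply, comp_apply, (Submodule.starProjection_apply_eq_zero_iff V).2 hy, map_zero,
      map_zero, inner_zero_right] at h2
    exact le_antisymm h2 (re_inner_nonneg (L.app_outer_nonneg j) y)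

end QOp

theorem PQPT.Eqv.den_eq {π : Option ℕ} {P Q : PQPT π} (h : P.Eqv Q) (v : ℕ → QPred) :
    P.den v = Q.den v := le_antisymm (h.1 v) (h.2 v)

theorem IncreasingTo.diag_eq_zero_iff {π : Option ℕ} {P : ℕ → PQPT π} {L : PQPT π}
    (h : IncreasingTo P L) (v : ℕ → QPred) (j : ℤ) :
    diag (L.den v) j = 0 ↔ ∀ n, diag ((P n).den v) j = 0 := by
  obtain ⟨E, E', R, -, hlim, hP, hL⟩ := h
  simp only [(hP _).den_eq, hL.den_eq, diag_pull_eq_zero_iff]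
  have : CompleteSpace (LinearMap.ker (R.den v).toLinearMap) :=
    (R.den v).isClosed_ker.completeSpace_coe
  exact hlim.forall_mem_iff j (LinearMap.ker (R.den v).toLinearMap)

/-! ## Derivations without substitution -/

/-- The condition on the values `A` and `B` of the pre- and postcondition under `v` that
derivability of a triple for `S` from `Γ` without substitution imposes. -/
def Sat (Γ : Set Triple) (v : ℕ → QPred) : Stmt → (H →L[ℂ] H) → (H →L[ℂ] H) → Prop
  | .bot, _, _ => True
  | .skip, A, B => A ≤ B
  | .init, _, _ => True
  | .unit U, A, B => A ≤ adjoint (U : H →L[ℂ] H) ∘L B ∘L (U : H →L[ℂ] H)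
  | .seq S T, A, B => ∃ C, Sat Γ v S A C ∧ Sat Γ v T C B
  | .cases M S, A, B => ∃ (π : Option ℕ) (C : M.J → PQPT π),
      A ≤ (PQPT.disj M.toQOp C).den v ∧ ∀ m, Sat Γ v (S m) ((C m).den v) B
  | .call, A, B => ∃ t ∈ Γ, A ≤ t.pre.den v ∧ t.post.den v ≤ B

theorem Sat.mono {Γ : Set Triple} {v : ℕ → QPred} {S : Stmt} {A A' B B' : H →L[ℂ] H}
    (h : Sat Γ v S A B) (hA : A' ≤ A) (hB : B ≤ B') : Sat Γ v S A' B' := by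
  induction S generalizing A A' B B' with
  | bot => trivial
  | skip => exact hA.trans (h.trans hB)
  | init => trivial
  | unit U => exact hA.trans (le_trans h (conj_mono hB _))
  | seq S T hS hT =>
    obtain ⟨C, h1, h2⟩ := h
    exact ⟨C, hS h1 hA le_rfl, hT h2 le_rfl hB⟩
  | cases M S hS =>
    obtain ⟨π, C, h1, h2⟩ := h
    exact ⟨π, C, hA.trans h1, fun m => hS m (h2 m) le_rfl hB⟩
  | call =>
    obtain ⟨t, ht, h1, h2⟩ := h
    exact ⟨t, ht, hA.trans h1, h2.trans hB⟩

/-- Every rule except (R Subst) preserves the condition at a fixed assignment `v`. For a call this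
leaves only a weakening of a single triple of `Γ`. -/
theorem Base.sat {Γ : Set Triple} (hΓ : ∀ t ∈ Γ, t.stmt = Stmt.call) {t : Triple}
    (h : Base False Γ t) (v : ℕ → QPred) : Sat Γ v t.stmt (t.pre.den v) (t.post.den v) := by
  induction h with
  | @hyp t h => rw [hΓ t h]; exact ⟨t, h, le_rfl, le_rfl⟩
  | bot P => trivial
  | skip P => exact le_rfl
  | init P => trivial
  | unit U P => exact (PQPT.den_pull_ofUnitary U P v).le
  | comp _ _ h₁ h₂ => exact ⟨_, h₁, h₂⟩
  | cases M _ h => exact ⟨_, _, le_rfl, h⟩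
  | order hP _ hQ h => exact h.mono (hP v) (hQ v)
  | subst R hsub _ _ => exact hsub.elim

/-! ## The diagonal of the weakest precondition of the bodies -/

theorem proj_ket (s : Set ℤ) [DecidablePred (· ∈ s)] (j : ℤ) :
    proj s (ket j) = if j ∈ s then ket j else 0 := by
  ext i
  rw [proj_apply]
  by_cases hij : i = j
  · subst hij
    by_cases h : i ∈ s <;> simp [h]
  · by_cases h : j ∈ s <;> by_cases h' : i ∈ s <;> simp [h, h', ket, hij]

theorem diag_disj_toyM {π : Option ℕ} (C : toyM.J → PQPT π) (v : ℕ → QPred) (j : ℤ) :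
    diag ((PQPT.disj toyM.toQOp C).den v) j =
      if j ≤ 0 then diag ((C (0 : Fin 2)).den v) j else diag ((C (1 : Fin 2)).den v) j := by
  have h := (PQPT.hasSum_den_disj toyM.toQOp C v (ket j) (ket j)).unique
    (hasSum_fintype (β := Fin 2) _)
  have h0 : toyM.toQOp.K (0 : Fin 2) (ket j) = if j ≤ 0 then ket j else 0 :=
    proj_ket {i | i ≤ 0} j
  have h1 : toyM.toQOp.K (1 : Fin 2) (ket j) = if 1 ≤ j then ket j else 0 :=
    proj_ket {i | 1 ≤ i} j
  rw [diag, h, Fin.sum_univ_two, h0, h1]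
  rcases le_or_gt j 0 with hj | hj
  · simp [hj, show ¬ (1 ≤ j) by omega, diag]
  · simp [not_le.2 hj, show 1 ≤ j by omega, diag]

theorem diag_conj_shiftU (k : ℤ) (B : H →L[ℂ] H) (j : ℤ) :
    diag (adjoint (shiftU k : H →L[ℂ] H) ∘L B ∘L (shiftU k : H →L[ℂ] H)) j = diag B (j + k) := by
  rw [diag, comp_apply, comp_apply, adjoint_inner_right, shiftU_ket, diag]

theorem diag_ketbra (n : ℤ) (v : ℕ → QPred) (j : ℤ) :
    diag ((PQPT.ketbra n).den v) j = if j = n then 1 else 0 := by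
  have h1 : diag ((PQPT.ketbra n).E.dual (PQPT.base v none)) j = 0 :=
    (QOp.hasSum_re_dual (PQPT.ketbra n).E _ (ket j)).unique (hasSum_empty (β := Empty))
  have h2 := (QOp.hasSum_re_dual (PQPT.ketbra n).F 1 (ket j)).unique (hasSum_unique (β := Unit) _)
  have h3 : diag ((PQPT.ketbra n).den v) j = diag ((PQPT.ketbra n).E.dual (PQPT.base v none)) j +
      (inner ℂ (ket j) ((PQPT.ketbra n).F.dual 1 (ket j))).re := by
    simp only [diag, PQPT.den, add_apply, inner_add_right, Complex.add_re]
  rw [h3, h1, h2, zero_add]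
  change (inner ℂ (outer n n (ket j)) (outer n n (ket j))).re = _
  rw [outer, InnerProductSpace.rankOne_apply, inner_ket]
  by_cases hj : j = n
  · subst hj
    have : (ket j) j = 1 := by simp [ket]
    rw [this, one_smul, inner_ket, this]
    simp
  · simp [ket, hj, Ne.symm hj]

/-! ### Diagonal constraints imposed by the bodies -/

/-- The first bound comes from the shift after the call. The second comes from the two branches:
`skip` on `j ≤ 0`, and the shift before the call on `j ≥ 1`. -/
theorem diag_le_of_toyBody {π : Option ℕ} {P P' Q Q' : PQPT π}
    (h : Base False {⟨P, Stmt.call, Q⟩} ⟨P', toyBody, Q'⟩) (v : ℕ → QPred) (j : ℤ) :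
    diag (Q.den v) j ≤ diag (Q'.den v) (j + 1) ∧
      diag (P'.den v) j ≤ if j ≤ 0 then diag (Q'.den v) j else diag (P.den v) (j - 1) := by
  obtain ⟨π', C, hP', hC⟩ := h.sat (by rintro _ rfl; rfl) v
  have h0 : (C (0 : Fin 2)).den v ≤ Q'.den v := hC (0 : Fin 2)
  obtain ⟨D₁, h1, D₂, ⟨t, rfl, h2, h3⟩, h4⟩ := hC (1 : Fin 2)
  have h34 := diag_mono (le_trans h3 h4) j
  have h12 := (diag_mono h1 j).trans_eq (diag_conj_shiftU _ _ _) |>.trans (diag_mono h2 _)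
  rw [diag_conj_shiftU] at h34
  refine ⟨h34, (diag_mono hP' j).trans ?_⟩
  rw [diag_disj_toyM]
  split_ifs
  · exact diag_mono h0 j
  · exact h12

theorem diag_le_of_toyBody' {π : Option ℕ} {P P' Q Q' : PQPT π}
    (h : Base False {⟨P, Stmt.call, Q⟩} ⟨P', toyBody', Q'⟩) (v : ℕ → QPred) (j : ℤ) :
    diag (Q.den v) j ≤ diag (Q'.den v) (j + 2) ∧
      diag (P'.den v) j ≤ if j ≤ 0 then diag (Q'.den v) j else diag (P.den v) (j - 1) := by
  obtain ⟨π', C, hP', hC⟩ := h.sat (by rintro _ rfl; rfl) v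
  have h0 : (C (0 : Fin 2)).den v ≤ Q'.den v := hC (0 : Fin 2)
  -- Only the precondition of the first call and the postcondition of the second matter; what links
  -- the two calls is discarded.
  obtain ⟨D₁, h1, D₂, ⟨t, rfl, h2, -⟩, D₃, -, D₄, ⟨t, rfl, -, h3⟩, h4⟩ := hC (1 : Fin 2)
  have h34 := diag_mono (le_trans h3 h4) j
  have h12 := (diag_mono h1 j).trans_eq (diag_conj_shiftU _ _ _) |>.trans (diag_mono h2 _)
  rw [diag_conj_shiftU] at h34
  refine ⟨h34, (diag_mono hP' j).trans ?_⟩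
  rw [diag_disj_toyM]
  split_ifs
  · exact diag_mono h0 j
  · exact h12

/-- If all postconditions have vanishing diagonal, then so do the preconditions of both bodies,
and they cannot exceed `|m⟩⟨m|`. -/
theorem not_ketbra_le_of_diag {π : Option ℕ} {P L : PQPT π} {Pn Qn : ℕ → PQPT π} {v : ℕ → QPred}
    {m : ℤ} (hinc : IncreasingTo Pn L) (h0 : (Pn 0).Eqv (PQPT.zero π)) (hP : P.Le L)
    (hQ : ∀ n j, diag ((Qn n).den v) j = 0)
    (hstep : ∀ n j, diag ((Pn (n + 1)).den v) j ≤
      if j ≤ 0 then diag ((Qn (n + 1)).den v) j else diag ((Pn n).den v) (j - 1)) :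
    ¬ (PQPT.ketbra m).den v ≤ P.den v := by
  intro hle
  have hz : ∀ n j, diag ((Pn n).den v) j = 0 := by
    intro n
    induction n with
    | zero =>
      intro j
      rw [h0.den_eq]
      have e := (QOp.hasSum_re_dual QOp.zero (PQPT.base v π) (ket j)).unique
        (hasSum_empty (β := Empty))
      have e' := (QOp.hasSum_re_dual QOp.zero 1 (ket j)).unique (hasSum_empty (β := Empty))
      change (inner ℂ (ket j) ((QOp.zero.dual (PQPT.base v π) + QOp.zero.dual 1) (ket j))).re = 0
      rw [add_apply, inner_add_right, Complex.add_re, e, e', add_zero]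
    | succ n ih =>
      intro j
      refine le_antisymm ((hstep n j).trans ?_) (diag_nonneg ((Pn (n + 1)).den_nonneg v) j)
      split_ifs
      · exact (hQ _ _).le
      · exact (ih _).le
  -- At `m` the diagonal of `|m⟩⟨m|` is `1`, while that of the supremum is `0`.
  have h1 := diag_mono (hle.trans (hP v)) m
  rw [(hinc.diag_eq_zero_iff v m).2 fun n => hz n m, diag_ketbra, if_pos rfl] at h1
  exact absurd h1 (by norm_num)

/-! ### Underivability without substitution -/

theorem not_provable_toyBody (m : ℤ) :
    ¬ Provable False toyBody ⟨PQPT.ketbra m, Stmt.call, PQPT.ketbra m⟩ := by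
  intro h
  -- The argument works at any assignment; the zero one is an arbitrary choice.
  let v : ℕ → QPred := fun _ => ⟨0, le_rfl, (nonneg_iff_isPositive _).2 isPositive_one⟩
  obtain ⟨_, ⟨Pn, hinc, h0, hstep, hP⟩, hpre, hpost⟩ := h.sat (by rintro _ ⟨⟩; rfl) v
  have hle := fun n j => diag_le_of_toyBody (hstep n) v j
  refine not_ketbra_le_of_diag (Qn := fun _ => _) hinc h0 hP (fun n j => ?_)
    (fun n j => (hle n j).2) hpre
  have hne : ∀ i, i ≠ m → diag (PQPT.den _ v) i ≤ 0 := fun i hi =>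
    (diag_mono hpost i).trans_eq ((diag_ketbra m v i).trans (if_neg hi))
  refine le_antisymm ?_ (diag_nonneg (PQPT.den_nonneg _ v) j)
  by_cases hj : j = m
  -- The postcondition is the same at all stages, so stage `0` serves; the shift moves `m` to `m +
  -- 1`, where the diagonal vanishes.
  · exact ((hle 0 j).1).trans (hne _ (by omega))
  · exact hne j hj

theorem not_provableVar_toyBody' (m : ℤ) :
    ¬ ProvableVar False toyBody' ⟨PQPT.ketbra m, Stmt.call, PQPT.ketbra m⟩ := by
  intro h
  let v : ℕ → QPred := fun _ => ⟨0, le_rfl, (nonneg_iff_isPositive _).2 isPositive_one⟩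
  obtain ⟨_, ⟨Pn, Qn, hinc, hinc', h0, hstep, hP, hQ⟩, hpre, hpost⟩ :=
    h.sat (by rintro _ ⟨⟩; rfl) v
  have hle := fun n j => diag_le_of_toyBody' (hstep n) v j
  refine not_ketbra_le_of_diag hinc h0 hP (fun n j => ?_) (fun n j => (hle n j).2) hpre
  -- The bound by `|m⟩⟨m|` is known only for the supremum of the `Qₙ`; zeros of its diagonal descend
  -- to each `Qₙ`.
  have hne : ∀ n i, i ≠ m → diag ((Qn n).den v) i = 0 := fun n i hi =>
    (hinc'.diag_eq_zero_iff v i).1 (le_antisymm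
      ((diag_mono ((hQ v).trans hpost) i).trans_eq ((diag_ketbra m v i).trans (if_neg hi)))
      (diag_nonneg (PQPT.den_nonneg _ v) i)) n
  by_cases hj : j = m
  · exact le_antisymm (((hle n j).1).trans_eq (hne _ _ (by omega)))
      (diag_nonneg (PQPT.den_nonneg _ v) j)
  · exact hne n j hj

/-! ## Derivations with substitution -/

/-- The subspaces `{|i⟩ : i ≤ 0}`, `|1⟩`, `|2⟩`, … on which `toy` acts separately. -/
def levelSet : ℕ → Set ℤ
  | 0 => {i | i ≤ 0}
  | n + 1 => {(n + 1 : ℤ)}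

/-- The levels are the fibres of `Int.toNat`, hence partition `ℤ`; in this form shifts of levels are
left to `omega`. -/
theorem mem_levelSet {k : ℕ} {i : ℤ} : i ∈ levelSet k ↔ i.toNat = k := by
  cases k with
  | zero => simp [levelSet]
  | succ k => simp only [levelSet, Set.mem_singleton_iff]; omega

theorem tsum_levelSet (x : H) : ∑' k, ‖proj (levelSet k) x‖ₑ ^ 2 = ‖x‖ₑ ^ 2 := by
  simp only [enorm_sq_lp, proj_apply]
  rw [ENNReal.tsum_comm]
  refine tsum_congr fun i => ?_
  rw [tsum_eq_single i.toNat]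
  · simp [mem_levelSet]
  · intro k hk
    simp [mem_levelSet, hk.symm]

/-- The semantics of `toy`: dephasing with respect to `levelSet`. -/
def dephase : QOp where
  ι := ℕ
  K k := proj (levelSet k)
  adm x := (tsum_levelSet x).le

/-- The `n`-th approximation of `dephase`. -/
def dephaseApprox (n : ℕ) : QOp where
  ι := Fin n
  K k := proj (levelSet k)
  adm x := (ENNReal.tsum_comp_le_tsum_of_injective Fin.val_injective
    fun k => ‖proj (levelSet k) x‖ₑ ^ 2).trans (tsum_levelSet x).le

theorem proj_singleton (i : ℤ) : proj {i} = outer i i := by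
  ext x j
  rw [proj_apply, outer, InnerProductSpace.rankOne_apply, inner_ket]
  by_cases h : j = i
  · subst h; simp [ket]
  · simp [ket, h]

/-! ### Convergence of the approximations -/

/-- Apart from level `0`, the summands have rank one and norm `⟨k|ρ|k⟩`, which is summable because
`ρ` has finite trace. -/
theorem summable_dephase {ρ : H →L[ℂ] H} (hρ : IsPDOP ρ) :
    Summable fun k => proj (levelSet k) ∘L ρ ∘L adjoint (proj (levelSet k)) := by
  refine (summable_nat_add_iff 1).1 (Summable.of_norm ?_)
  have h : ∀ k : ℕ, ‖proj (levelSet (k + 1)) ∘L ρ ∘L adjoint (proj (levelSet (k + 1)))‖ =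
      (inner ℂ (ket (k + 1)) (ρ (ket (k + 1)))).re := by
    intro k
    have h0 := (hρ.1.inner_nonneg_right (ket (k + 1)))
    rw [levelSet, proj_singleton, outer, InnerProductSpace.adjoint_rankOne,
      InnerProductSpace.comp_rankOne, InnerProductSpace.comp_rankOne,
      InnerProductSpace.norm_rankOne, InnerProductSpace.rankOne_apply, norm_smul, norm_ket,
      mul_one, mul_one]
    exact (Complex.re_eq_norm.2 h0).symm
  simp only [h]
  refine hρ.2.1.comp_injective (i := fun k : ℕ => ((k : ℤ) + 1)) fun a b hab => ?_
  simpa using hab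

theorem app_dephaseApprox (n : ℕ) (ρ : H →L[ℂ] H) : (dephaseApprox n).app ρ =
    ∑ k ∈ Finset.range n, proj (levelSet k) ∘L ρ ∘L adjoint (proj (levelSet k)) := by
  rw [Finset.sum_range]
  exact tsum_fintype (β := Fin n) (L := SummationFilter.unconditional (Fin n)) _

theorem dephaseApprox_le (n : ℕ) : (dephaseApprox n).Le (dephaseApprox (n + 1)) := by
  intro ρ hρ
  rw [app_dephaseApprox, app_dephaseApprox, Finset.sum_range_succ]
  exact le_add_of_nonneg_right ((nonneg_iff_isPositive _).2 (hρ.1.conj_adjoint _))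

theorem isLimit_dephaseApprox : QOp.IsLimit dephaseApprox dephase := by
  intro ρ hρ
  simp only [app_dephaseApprox]
  refine isLUB_of_tendsto_atTop (monotone_nat_of_le_succ fun n => ?_)
    (summable_dephase hρ).hasSum.tendsto_sum_nat
  rw [Finset.sum_range_succ]
  exact le_add_of_nonneg_right ((nonneg_iff_isPositive _).2 (hρ.1.conj_adjoint _))

theorem increasingTo_dephase : IncreasingTo (fun n => (PQPT.var 0).pull (dephaseApprox n))
    ((PQPT.var 0).pull dephase) :=
  ⟨_, _, _, dephaseApprox_le, isLimit_dephaseApprox, fun _ => PQPT.Eqv.refl _, PQPT.Eqv.refl _⟩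

theorem eqv_pull_one {π : Option ℕ} (P : PQPT π) : P.Eqv (P.pull (QOp.ofUnitary 1)) := by
  have h : ∀ v, P.den v = (P.pull (QOp.ofUnitary 1)).den v := by
    intro v
    rw [PQPT.den_pull_ofUnitary]
    ext1 x
    refine ext_inner_left ℂ fun y => ?_
    rw [comp_apply, comp_apply, adjoint_inner_right]
    rfl
  exact ⟨fun v => (h v).le, fun v => (h v).ge⟩

/-- The identity operation, taken as a constant sequence, exhibits `P` in the form demanded of
increasing sequences. -/
theorem increasingTo_const {π : Option ℕ} (P : PQPT π) : IncreasingTo (fun _ => P) P :=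
  ⟨fun _ => QOp.ofUnitary 1, QOp.ofUnitary 1, P, fun _ _ _ => le_rfl,
    fun _ _ => by simp only [Set.range_const, isLUB_singleton],
    fun _ => eqv_pull_one P, eqv_pull_one P⟩

/-- The precondition `𝒳` restricted to the inputs on which `toy` recurses less than `n` times. -/
def levelTerm (n : ℕ) : PQPT (some 0) := (PQPT.var 0).pull (dephaseApprox n)

theorem levelTerm_zero : (levelTerm 0).Eqv (PQPT.zero (some 0)) := by
  constructor
  · refine PQPT.le_of_injective (fun a => a.1.elim0) (fun a => a.1.elim0) (fun a => a.1.elim0)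
      (fun a => a.1.elim0) (fun a => a.1.elim0) (fun a => a.1.elim0)
  · refine PQPT.le_of_injective Empty.elim (fun a => a.elim) (fun a => a.elim)
      Empty.elim (fun a => a.elim) (fun a => a.elim)

/-! ### Inductive step for the bodies -/

theorem var_subst_le {π : Option ℕ} (R : PQPT π) : ((PQPT.var 0).subst R).Le R := by
  refine PQPT.le_of_injective (fun a => a.2) ?_ (fun _ => rfl)
    (fun a => Sum.elim (fun b => b.2) Empty.elim a) ?_ ?_
  · rintro ⟨⟨⟩, a⟩ ⟨⟨⟩, b⟩ h
    exact congrArg (Prod.mk ()) h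
  · rintro (⟨⟨⟩, a⟩ | ⟨⟨⟩⟩) (⟨⟨⟩, b⟩ | ⟨⟨⟩⟩) h
    exact congrArg (fun c => Sum.inl ((), c)) h
  · rintro (⟨⟨⟩, a⟩ | ⟨⟨⟩⟩)
    rfl

/-- This is where (R Subst) enters the inductive step: one assumption about `𝒳` serves a call with
an arbitrary postcondition `R`. -/
theorem base_call_subst (n : ℕ) {π : Option ℕ} (R : PQPT π) :
    Base True {⟨levelTerm n, Stmt.call, PQPT.var 0⟩} ⟨(levelTerm n).subst R, Stmt.call, R⟩ :=
  .order (PQPT.Le.refl _) (.subst R trivial (.hyp rfl)) (var_subst_le R)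

open Classical in
theorem proj_apply_ite (s : Set ℤ) (f : H) (i : ℤ) : proj s f i = if i ∈ s then f i else 0 :=
  (proj_apply s f i).trans (Set.indicator_apply s f i)

theorem shiftU_apply (k : ℤ) (f : H) (i : ℤ) : (shiftU k : H →L[ℂ] H) f i = f (i - k) := rfl

/-- One run through the recursive branch takes level `k + 1` down to level `k` and back. -/
theorem proj_levelSet_succ (k : ℕ) : proj (levelSet (k + 1)) =
    (shiftU 1 : H →L[ℂ] H) ∘L proj (levelSet k) ∘L (shiftU (-1) : H →L[ℂ] H) ∘L
      proj {i | 1 ≤ i} := by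
  ext f i
  simp only [comp_apply, shiftU_apply, proj_apply_ite, mem_levelSet, Set.mem_ofPred_eq]
  rw [show i - 1 - -1 = i by ring]
  split_ifs <;> first | rfl | omega

/-- The second call starts one level lower. Truncated subtraction is correct at `k = 0`: the shift
takes `0` to `-1`, which is still in level `0`. -/
theorem proj_levelSet_succ' (k : ℕ) : proj (levelSet (k + 1)) =
    (shiftU 2 : H →L[ℂ] H) ∘L proj (levelSet (k - 1)) ∘L (shiftU (-1) : H →L[ℂ] H) ∘L
      proj (levelSet k) ∘L (shiftU (-1) : H →L[ℂ] H) ∘L proj {i | 1 ≤ i} := by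
  ext f i
  simp only [comp_apply, shiftU_apply, proj_apply_ite, mem_levelSet, Set.mem_ofPred_eq]
  rw [show i - 2 - -1 - -1 = i by ring]
  split_ifs <;> first | rfl | omega

theorem levelTerm_succ_le (n : ℕ) : (levelTerm (n + 1)).Le (PQPT.disj toyM.toQOp
    (![PQPT.var 0, ((levelTerm n).subst ((PQPT.var 0).pull (QOp.ofUnitary (shiftU 1)))).pull
      (QOp.ofUnitary (shiftU (-1)))] : Fin 2 → PQPT (some 0))) := by
  refine PQPT.le_of_injective
    -- Level `0` is matched with the `skip` branch, level `k + 1` with the Kraus operator of the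
    -- recursive branch whose call runs at level `k`.
    (fun a => Fin.cases (motive := fun _ => Sigma _) ⟨(0 : Fin 2), ()⟩
      (fun k => ⟨(1 : Fin 2), ⟨(), ⟨⟨k, ()⟩, ⟨(), ()⟩⟩⟩⟩) a.1) ?_ ?_
    (fun a => a.2.elim) (fun a => a.2.elim) (fun a => a.2.elim)
  · rintro ⟨a, ⟨⟩⟩ ⟨b, ⟨⟩⟩ h
    have hab : a = b := by
      induction a using Fin.cases with
      | zero =>
        induction b using Fin.cases with
        | zero => rfl
        | succ b => exact absurd (congrArg Sigma.fst h) (Fin.zero_ne_one (n := 0))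
      | succ a =>
        induction b using Fin.cases with
        | zero => exact absurd (congrArg Sigma.fst h) (Fin.zero_ne_one (n := 0)).symm
        | succ b =>
          exact congrArg (fun c => Fin.succ c.2.1.1) (eq_of_heq (Sigma.mk.inj h).2)
    rw [hab]
  · rintro ⟨a, ⟨⟩⟩
    induction a using Fin.cases with
    | zero => rfl
    | succ k => exact proj_levelSet_succ k

theorem base_toyBody (n : ℕ) : Base True {⟨levelTerm n, Stmt.call, PQPT.var 0⟩}
    ⟨levelTerm (n + 1), toyBody, PQPT.var 0⟩ := by
  refine .order (levelTerm_succ_le n) (.cases toyM fun m => ?_) (PQPT.Le.refl _)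
  revert m
  refine Fin.forall_fin_two.2 ⟨.skip _, ?_⟩
  exact .comp (.unit _ _) (.comp (base_call_subst n _) (.unit _ _))

theorem levelTerm_succ_le' (n : ℕ) : (levelTerm (n + 1)).Le (PQPT.disj toyM.toQOp
    (![PQPT.var 0, ((levelTerm n).subst (((levelTerm n).subst
      ((PQPT.var 0).pull (QOp.ofUnitary (shiftU 2)))).pull (QOp.ofUnitary (shiftU (-1))))).pull
      (QOp.ofUnitary (shiftU (-1)))] : Fin 2 → PQPT (some 0))) := by
  refine PQPT.le_of_injective
    -- For level `k + 1` the two calls run at levels `k` and `k - 1`, both below `n`. The remaining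
    -- pairs of levels are not needed for an inequality.
    (fun a => Fin.cases (motive := fun _ => Sigma _) ⟨(0 : Fin 2), ()⟩
      (fun k => ⟨(1 : Fin 2), ⟨(), ⟨⟨k, ()⟩, ⟨(), ⟨⟨⟨(k : ℕ) - 1, by omega⟩, ()⟩, ⟨(), ()⟩⟩⟩⟩⟩⟩)
      a.1) ?_ ?_
    (fun a => a.2.elim) (fun a => a.2.elim) (fun a => a.2.elim)
  · rintro ⟨a, ⟨⟩⟩ ⟨b, ⟨⟩⟩ h
    have hab : a = b := by
      induction a using Fin.cases with
      | zero =>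
        induction b using Fin.cases with
        | zero => rfl
        | succ b => exact absurd (congrArg Sigma.fst h) (Fin.zero_ne_one (n := 0))
      | succ a =>
        induction b using Fin.cases with
        | zero => exact absurd (congrArg Sigma.fst h) (Fin.zero_ne_one (n := 0)).symm
        | succ b =>
          exact congrArg (fun c => Fin.succ c.2.1.1) (eq_of_heq (Sigma.mk.inj h).2)
    rw [hab]
  · rintro ⟨a, ⟨⟩⟩
    induction a using Fin.cases with
    | zero => rfl
    | succ k => exact proj_levelSet_succ' k

theorem base_toyBody' (n : ℕ) : Base True {⟨levelTerm n, Stmt.call, PQPT.var 0⟩}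
    ⟨levelTerm (n + 1), toyBody', PQPT.var 0⟩ := by
  refine .order (levelTerm_succ_le' n) (.cases toyM fun m => ?_) (PQPT.Le.refl _)
  revert m
  refine Fin.forall_fin_two.2 ⟨.skip _, ?_⟩
  exact .comp (.unit _ _) (.comp (base_call_subst n _) (.comp (.unit _ _)
    (.comp (base_call_subst n _) (.unit _ _))))

/-- The Kraus operator of `dephase` at level `n` suffices, because `|n⟩` lies in that level and
`|n⟩⟨n| Πₙ = |n⟩⟨n|`. -/
theorem ketbra_le_subst (n : ℕ) :
    (PQPT.ketbra n).Le (((PQPT.var 0).pull dephase).subst (PQPT.ketbra n)) := by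
  refine PQPT.le_of_injective (fun a => a.elim) (fun a => a.elim) (fun a => a.elim)
    (fun _ => Sum.inl ⟨⟨n, ()⟩, ()⟩) (fun _ _ _ => rfl) fun _ => ?_
  change outer n n = outer n n ∘L (1 : H →L[ℂ] H) ∘L proj (levelSet n)
  ext f i
  simp [outer, inner_ket, proj_apply, mem_levelSet]

/-! ### Derivability with substitution -/

theorem provable_toyBody (n : ℕ) :
    Provable True toyBody ⟨PQPT.ketbra n, Stmt.call, PQPT.ketbra n⟩ :=
  .order (ketbra_le_subst n) (.subst (PQPT.ketbra n) trivial (.hyp (.intro levelTerm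
    increasingTo_dephase levelTerm_zero base_toyBody (PQPT.Le.refl _)))) (var_subst_le _)

theorem provableVar_toyBody' (n : ℕ) :
    ProvableVar True toyBody' ⟨PQPT.ketbra n, Stmt.call, PQPT.ketbra n⟩ :=
  .order (ketbra_le_subst n) (.subst (PQPT.ketbra n) trivial (.hyp (.intro levelTerm
    -- Constant postconditions are enough for the variant rule.
    (fun _ => PQPT.var 0) increasingTo_dephase (increasingTo_const _) levelTerm_zero
    base_toyBody' (PQPT.Le.refl _) (PQPT.Le.refl _)))) (var_subst_le _)

end QHL

end

theorem mainTheorem9 (n : ℕ) :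
    -- with (Rt Rec): derivable with (R Subst), underivable without it
    (QHL.Provable True QHL.toyBody ⟨QHL.PQPT.ketbra n, QHL.Stmt.call, QHL.PQPT.ketbra n⟩ ∧
      ¬ QHL.Provable False QHL.toyBody ⟨QHL.PQPT.ketbra n, QHL.Stmt.call, QHL.PQPT.ketbra n⟩) ∧
    -- with the variant of (Rt Rec) with increasing postconditions, for the redefined body
    (QHL.ProvableVar True QHL.toyBody' ⟨QHL.PQPT.ketbra n, QHL.Stmt.call, QHL.PQPT.ketbra n⟩ ∧
      ¬ QHL.ProvableVar False QHL.toyBody'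
        ⟨QHL.PQPT.ketbra n, QHL.Stmt.call, QHL.PQPT.ketbra n⟩) := by
  exact ⟨⟨QHL.provable_toyBody n, QHL.not_provable_toyBody n⟩,
    QHL.provableVar_toyBody' n, QHL.not_provableVar_toyBody' n⟩
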